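/- A (right) Bol loop is a set $S$ with a multiplication and a two-sided unit $e$ such that the equations $ax=b$ and $ya=b$ are uniquely solvable and $((xy)z)y=x((yz)y)$ holds; $x^{-1}$ denotes the inverse of $x$. The universal group $\widetilde G(S)$ is the group with generators $P_x,R_x$ $(x\in S)$ and defining relations $P_e=R_e=1$, $P_{x^{-1}}=P_x^{-1}$, $R_{x^{-1}}=R_x^{-1}$, $P_{(xy)x}=P_xP_yP_x$, $R_{(xy)x}=R_xR_yR_x$, $P_xP_yP_{xy}^{-1}=R_x^{-1}R_y^{-1}R_{xy}$. It has the automorphism $\sigma$ with $\sigma^2=1$, $P_x^\sigma=R_x^{-1}$, $R_x^\sigma=P_x^{-1}$. Put $L_x=P_x^{-1}R_x^{-1}$, let $J$ be the subgroup of $\widetilde G(S)$ generated by all $L_xR_x^{-1}$, $R_xR_yR_{xy}^{-1}$, $L_xL_yL_{yx}^{-1}$, and let $G_0(S)$ be the quotient of $\widetilde G(S)$ by the largest normal $\sigma$-invariant subgroup contained in $J^\sigma$. Let $G$ be a group with an automorphism $\sigma$ with $\sigma^2=1$, let $G_\sigma=\{x^{-1}x^\sigma\mid x\in G\}$ and $N=\langle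 G_\sigma\rangle$, let $\varphi:N\to G$ be a homomorphism, and let $I$ be the group of the elements of $\varphi(N)$ fixed by $\sigma$. Then $G$ is a $(\sigma,\varphi)$-group if $G$ is generated by $\varphi(G_\sigma)\cup\varphi(G_\sigma)^\sigma$, $\varphi(\varphi(x)^{-1}\varphi(x)^\sigma)=\varphi(x)$ for all $x\in G_\sigma$, and every coset $Ig$ with $g\in\varphi(N)$ meets $\varphi(G_\sigma)$. It is associated with $S$ if there is a bijection $x\mapsto P_x$ of $S$ onto $\varphi(G_\sigma)$ with $IP_xP_y=IP_{xy}$ for all $x,y\in S$. **Theorem 3.** Let $S$ be a finite Bol loop. Then $\widetilde G(S)$ is residually finite (the intersection of its normal subgroups of finite index is trivial). Moreover the minimal group associated with $S$ is finite, that is: the group $G_0(S)$ is finite; every group $G$ associated with $S$ such that each group associated with $S$ has a homomorphic image isomorphic to $G$ is finite; and every $(\sigma,\varphi)$-group $G$ associated with $S$ is finite if each surjective homomorphism of $G$, compatible with $\sigma$ and $\varphi$, onto a $(\sigma',\varphi')$-group associated with $S$ is an isomorphism. -/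

import Mathlib

universe u

/-- A (right) Bol loop: a set with a multiplication and a two-sided unit such that the equations
`a x = b` and `y a = b` are uniquely solvable, and `((x y) z) y = x ((y z) y)` holds. -/
class BolLoop (S : Type*) extends MulOneClass S where
  existsUnique_mul_left : ∀ a b : S, ∃! x : S, a * x = b
  existsUnique_mul_right : ∀ a b : S, ∃! y : S, y * a = b
  bol : ∀ x y z : S, ((x * y) * z) * y = x * ((y * z) * y)

namespace BolLoop

section Loop

variable {S : Type*} [BolLoop S]

/-- The inverse `x⁻¹` of an element of a Bol loop. -/
noncomputable def inverse (x : S) : S := (existsUnique_mul_left x 1).exists.choose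

theorem mul_inverse (x : S) : x * inverse x = 1 :=
  (existsUnique_mul_left x 1).exists.choose_spec

theorem eq_inverse_of_mul {x y : S} (h : x * y = 1) : y = inverse x :=
  (existsUnique_mul_left x 1).unique h (mul_inverse x)

theorem inverse_mul (x : S) : inverse x * x = 1 := by
  have h := bol x (inverse x) x
  rw [mul_inverse, one_mul, mul_inverse] at h
  have h2 := eq_inverse_of_mul h.symm
  exact (existsUnique_mul_right (inverse x) (inverse x)).unique h2 (one_mul _)

end Loop

section Universal

variable (S : Type*) [BolLoop S]

/-- The two families of generators `P_x`, `R_x` of the universal group. -/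
inductive Generator (S : Type*) : Type _
  | P (x : S) : Generator S
  | R (x : S) : Generator S

open Generator in
/-- The defining relators of the universal group. -/
inductive Relator : FreeGroup (Generator S) → Prop
  | P_one : Relator (.of (P 1))
  | R_one : Relator (.of (R 1))
  | P_inv (x : S) : Relator (.of (P (inverse x)) * .of (P x))
  | R_inv (x : S) : Relator (.of (R (inverse x)) * .of (R x))
  | P_mul (x y : S) : Relator
      (.of (P ((x * y) * x)) * (.of (P x) * .of (P y) * .of (P x))⁻¹)
  | R_mul (x y : S) : Relator
      (.of (R ((x * y) * x)) * (.of (R x) * .of (R y) * .of (R x))⁻¹)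
  | P_R (x y : S) : Relator
      ((.of (P x) * .of (P y) * (.of (P (x * y)))⁻¹) *
        ((.of (R x))⁻¹ * (.of (R y))⁻¹ * .of (R (x * y)))⁻¹)

/-- The universal group `G̃(S)` of a Bol loop `S`: generators `P_x`, `R_x` (`x ∈ S`), relations
`P_1 = R_1 = 1`, `P_{x⁻¹} = P_x⁻¹`, `R_{x⁻¹} = R_x⁻¹`, `P_{(xy)x} = P_x P_y P_x`,
`R_{(xy)x} = R_x R_y R_x`, `P_x P_y P_{xy}⁻¹ = R_x⁻¹ R_y⁻¹ R_{xy}`. -/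
abbrev UniversalGroup : Type _ := PresentedGroup {r | Relator S r}

variable {S}

namespace UniversalGroup

/-- The generator `P_x`. -/
def P (x : S) : UniversalGroup S := PresentedGroup.of (Generator.P x)

/-- The generator `R_x`. -/
def R (x : S) : UniversalGroup S := PresentedGroup.of (Generator.R x)

theorem P_one : P (1 : S) = 1 := PresentedGroup.one_of_mem (x := .of (Generator.P 1)) .P_one

theorem R_one : R (1 : S) = 1 := PresentedGroup.one_of_mem (x := .of (Generator.R 1)) .R_one

theorem P_inv (x : S) : P (inverse x) = (P x)⁻¹ :=
  eq_inv_of_mul_eq_one_left (PresentedGroup.one_of_mem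
    (rels := {r | Relator S r}) (Relator.P_inv x))

theorem R_inv (x : S) : R (inverse x) = (R x)⁻¹ :=
  eq_inv_of_mul_eq_one_left (PresentedGroup.one_of_mem
    (rels := {r | Relator S r}) (Relator.R_inv x))

theorem P_mul (x y : S) : P ((x * y) * x) = P x * P y * P x :=
  mul_inv_eq_one.1 (PresentedGroup.one_of_mem (rels := {r | Relator S r}) (Relator.P_mul x y))

theorem R_mul (x y : S) : R ((x * y) * x) = R x * R y * R x :=
  mul_inv_eq_one.1 (PresentedGroup.one_of_mem (rels := {r | Relator S r}) (Relator.R_mul x y))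

theorem P_R (x y : S) : P x * P y * (P (x * y))⁻¹ = (R x)⁻¹ * (R y)⁻¹ * R (x * y) :=
  mul_inv_eq_one.1 (PresentedGroup.one_of_mem (rels := {r | Relator S r}) (Relator.P_R x y))

/-- The endomorphism of `G̃(S)` with `P_x ↦ R_x⁻¹`, `R_x ↦ P_x⁻¹`. -/
def sigmaHom : UniversalGroup S →* UniversalGroup S :=
  PresentedGroup.toGroup
    (f := fun g : Generator S => match g with
      | .P x => (R x)⁻¹
      | .R x => (P x)⁻¹)
    (by
      rintro r (_ | _ | x | x | ⟨x, y⟩ | ⟨x, y⟩ | ⟨x, y⟩)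
      · simp [R_one]
      · simp [P_one]
      · simp [R_inv]
      · simp [P_inv]
      · simp [R_mul, mul_assoc]
      · simp [P_mul, mul_assoc]
      · have h := P_R x y
        simp only [map_mul, map_inv, FreeGroup.lift_apply_of, inv_inv]
        rw [h]
        group)

theorem sigmaHom_P (x : S) : sigmaHom (P x) = (R x)⁻¹ := PresentedGroup.toGroup.of _

theorem sigmaHom_R (x : S) : sigmaHom (R x) = (P x)⁻¹ := PresentedGroup.toGroup.of _

theorem sigmaHom_comp_self :
    (sigmaHom (S := S)).comp sigmaHom = MonoidHom.id (UniversalGroup S) := by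
  refine PresentedGroup.ext fun g => ?_
  cases g with
  | P x =>
    change sigmaHom (sigmaHom (P x)) = P x
    rw [sigmaHom_P, map_inv, sigmaHom_R, inv_inv]
  | R x =>
    change sigmaHom (sigmaHom (R x)) = R x
    rw [sigmaHom_R, map_inv, sigmaHom_P, inv_inv]

/-- The involutory automorphism `σ` of `G̃(S)` with `P_x^σ = R_x⁻¹`, `R_x^σ = P_x⁻¹`. -/
def sigma : MulAut (UniversalGroup S) :=
  MonoidHom.toMulEquiv sigmaHom sigmaHom sigmaHom_comp_self sigmaHom_comp_self

/-- `L_x = P_x⁻¹ R_x⁻¹`. -/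
def L (x : S) : UniversalGroup S := (P x)⁻¹ * (R x)⁻¹

variable (S)

/-- The subgroup `J` of `G̃(S)` generated by the elements `T_x = L_x R_x⁻¹`,
`R_{x,y} = R_x R_y R_{xy}⁻¹` and `L_{x,y} = L_x L_y L_{yx}⁻¹`. -/
def J : Subgroup (UniversalGroup S) :=
  Subgroup.closure
    ((Set.range fun x : S => L x * (R x)⁻¹) ∪
      (Set.range fun p : S × S => R p.1 * R p.2 * (R (p.1 * p.2))⁻¹) ∪
      (Set.range fun p : S × S => L p.1 * L p.2 * (L (p.2 * p.1))⁻¹))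

/-- The image `J^σ` of `J` under `σ`. -/
def Jsigma : Subgroup (UniversalGroup S) := (J S).map sigma.toMonoidHom

/-- The largest normal `σ`-invariant subgroup of `G̃(S)` contained in `J^σ`: the intersection of
the images of `J^σ` under all inner automorphisms, and of the images of that under `⟨σ⟩`. -/
def sigmaCore : Subgroup (UniversalGroup S) :=
  (Jsigma S).normalCore ⊓ ((Jsigma S).normalCore).map sigma.toMonoidHom

instance sigmaCore_normal : (sigmaCore S).Normal := by
  have : (((Jsigma S).normalCore).map (sigma (S := S)).toMonoidHom).Normal :=
    Subgroup.Normal.map inferInstance _ (sigma (S := S)).surjective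
  unfold sigmaCore
  infer_instance

end UniversalGroup

variable (S)

/-- The group `G₀(S)`, the quotient of `G̃(S)` by the largest normal `σ`-invariant subgroup
contained in `J^σ`. -/
abbrev GroupZero : Type _ := UniversalGroup S ⧸ UniversalGroup.sigmaCore S

end Universal

section SigmaPhi

variable {G : Type*} [Group G]

/-- The set `G_σ = {x⁻¹ x^σ | x ∈ G}`. -/
def sigmaSet (σ : MulAut G) : Set G := {g | ∃ x : G, g = x⁻¹ * σ x}

/-- The subgroup `N` of `G` generated by `G_σ`. -/
def sigmaSubgroup (σ : MulAut G) : Subgroup G := Subgroup.closure (sigmaSet σ)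

/-- The set `φ(G_σ)`. -/
def phiSet (σ : MulAut G) (φ : sigmaSubgroup σ →* G) : Set G :=
  {g | ∃ x : sigmaSubgroup σ, (x : G) ∈ sigmaSet σ ∧ φ x = g}

/-- The subgroup `I` of the elements of `φ(N)` fixed by `σ`. -/
def fixedSubgroup (σ : MulAut G) (φ : sigmaSubgroup σ →* G) : Subgroup G where
  carrier := {g | g ∈ φ.range ∧ σ g = g}
  mul_mem' := fun ha hb => ⟨mul_mem ha.1 hb.1, by rw [map_mul, ha.2, hb.2]⟩
  one_mem' := ⟨one_mem _, map_one σ⟩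
  inv_mem' := fun ha => ⟨inv_mem ha.1, by rw [map_inv, ha.2]⟩

/-- `G` is a `(σ, φ)`-group. -/
structure IsSigmaPhiGroup (σ : MulAut G) (φ : sigmaSubgroup σ →* G) : Prop where
  involutory : ∀ g : G, σ (σ g) = g
  generate : Subgroup.closure (phiSet σ φ ∪ σ '' phiSet σ φ) = ⊤
  phi_phi : ∀ x ∈ phiSet σ φ, φ ⟨x⁻¹ * σ x, Subgroup.subset_closure ⟨x, rfl⟩⟩ = x
  coset : ∀ g ∈ φ.range, ∃ x ∈ phiSet σ φ, x * g⁻¹ ∈ fixedSubgroup σ φ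

/-- The `(σ, φ)`-group `G` and the Bol loop `S` are associated: there is a bijection `x ↦ P_x` of
`S` onto `φ(G_σ)` such that `I P_x P_y = I P_{xy}`, so that `S` is the Bol loop `S(G)` up to
isomorphism. -/
structure IsAssociated (S : Type*) [BolLoop S] (σ : MulAut G) (φ : sigmaSubgroup σ →* G) :
    Prop where
  isSigmaPhiGroup : IsSigmaPhiGroup σ φ
  exists_bijOn : ∃ P : S → G, Set.BijOn P Set.univ (phiSet σ φ) ∧
    ∀ x y : S, (P x * P y) * (P (x * y))⁻¹ ∈ fixedSubgroup σ φ

/-- `G` is associated with `S`, and every group associated with `S` has a homomorphic image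
isomorphic to `G`. -/
def IsLeastAssociated (S : Type u) [BolLoop S] {G : Type u} [Group G]
    (σ : MulAut G) (φ : sigmaSubgroup σ →* G) : Prop :=
  IsAssociated S σ φ ∧
    ∀ (H : Type u) [Group H] (τ : MulAut H) (ψ : sigmaSubgroup τ →* H),
      IsAssociated S τ ψ → ∃ f : H →* G, Function.Surjective f

/-- `G` is associated with `S` and has no proper quotient, as a `(σ, φ)`-group, that is
associated with `S`. -/
def IsMinimalAssociated (S : Type u) [BolLoop S] {G : Type u} [Group G]
    (σ : MulAut G) (φ : sigmaSubgroup σ →* G) : Prop :=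
  IsAssociated S σ φ ∧
    ∀ (H : Type u) [Group H] (τ : MulAut H) (ψ : sigmaSubgroup τ →* H) (f : G →* H),
      IsAssociated S τ ψ → Function.Surjective f → (∀ g : G, f (σ g) = τ (f g)) →
      (∀ (n : sigmaSubgroup σ) (m : sigmaSubgroup τ), (m : H) = f n → ψ m = f (φ n)) →
      Function.Injective f

end SigmaPhi

end BolLoop

/-! ### Residual finiteness of free groups and of their finite extensions -/

/-! Everything rests on one fact, `Group.finite_of_twisted`: a group generated by a finite set
containing 1 and closed under `x * y * x` is finite.

Residual finiteness. The elements `P x` form such a set, so the folding map `P x ↦ P x`, `R x ↦ (P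
x)⁻¹` has finite image. Its kernel lies in the normal subgroup generated by the `L x`, and
`toSemidirect` embeds that subgroup in the semidirect product of the free group on `S` with the
symmetric group of `S`. This product is residually finite, so each nontrivial element is detected
either by folding or by `toSemidirect`.

The group `GroupZero S`. The right cosets of `J` represented by the `R x` exhaust the group, so `J`
has finite index, and so has the σ-invariant core of its image under σ.

Associated groups. The set `phiSet σ φ` is finite and twisted, so φ(N) is finite. Since σ acts
trivially on G/N, that quotient is an image of φ(N). Hence ker φ has finite index in G and contains
M ∩ N for some normal σ-invariant M of finite index. The quotient G/M is again associated with `S`.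
A least group is an image of this finite group, and a minimal group is isomorphic to it. -/

theorem Subgroup.FiniteIndex.comap {G H : Type*} [Group G] [Group H] (f : G →* H) {K : Subgroup H}
    (hK : K.FiniteIndex) : (K.comap f).FiniteIndex :=
  have := Subgroup.isFiniteRelIndex_of_finiteIndex (H := K) (K := f.range)
  ⟨by rw [Subgroup.index_comap]; exact Subgroup.relIndex_ne_zero⟩

/-- A partial injection of a finite set has domain and range of equal size, so their complements can
be matched. -/
theorem Set.Finite.exists_perm_extending {α : Type*} {V : Set α} (hV : V.Finite)
    (f : Equiv.Perm α) : ∃ p : Equiv.Perm V, ∀ v : V, f v ∈ V → (p v : α) = f v := by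
  classical
  have := hV.fintype
  let e : {v : V // f v ∈ V} ≃ {v : V // f.symm v ∈ V} :=
    { toFun := fun v => ⟨⟨f v, v.2⟩, by simp⟩
      invFun := fun v => ⟨⟨f.symm v, v.2⟩, by simp⟩
      left_inv := fun v => by simp
      right_inv := fun v => by simp }
  refine ⟨e.extendSubtype, fun v hv => ?_⟩
  rw [Equiv.extendSubtype_apply_of_mem e v hv]
  rfl

namespace FreeGroup

/-- Left multiplication by each generator is a partial injection on the finite set of suffixes of
the word. Extended to permutations, the generators let the word carry 1 to its own value, which is
not 1. -/
instance residuallyFinite (α : Type*) : Group.ResiduallyFinite (FreeGroup α) := by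
  refine Group.residuallyFinite_iff_exists_finiteIndex.2 fun w hw => ?_
  obtain ⟨L, rfl⟩ := Quot.exists_rep w
  change mk L ≠ 1 at hw
  let V : Set (FreeGroup α) := {v | ∃ M, M <:+ L ∧ mk M = v}
  have hV : V.Finite := by
    refine (L.tails.finite_toSet.image mk).subset ?_
    rintro _ ⟨M, hM, rfl⟩
    exact ⟨M, by simpa using hM, rfl⟩
  have := hV.to_subtype
  choose p hp using fun a : α => hV.exists_perm_extending (Equiv.mulLeft (of a))
  have key : ∀ M (hM : M <:+ L),
      lift p (mk M) ⟨1, [], List.nil_suffix, rfl⟩ = ⟨mk M, M, hM, rfl⟩ := by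
    intro M
    induction M with
    | nil => intro _; rfl
    | cons l M ih =>
      intro hM
      have hM' : M <:+ L := (List.suffix_cons l M).trans hM
      have hmk : mk (l :: M) = mk [l] * mk M := by rw [mul_mk]; rfl
      obtain ⟨a, b⟩ := l
      have hsplit : lift p (mk ((a, b) :: M)) = lift p (mk [(a, b)]) * lift p (mk M) := by
        rw [hmk, _root_.map_mul]
      rw [hsplit, Equiv.Perm.mul_apply, ih hM']
      cases b with
      | true =>
        have h := hp a ⟨mk M, M, hM', rfl⟩ ⟨_, hM, hmk⟩
        refine Subtype.ext ?_
        change ((lift p (of a)) _ : FreeGroup α) = _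
        rw [lift_apply_of, h]
        exact hmk.symm
      | false =>
        have hinv : (mk [(a, false)] : FreeGroup α) = (of a)⁻¹ := rfl
        rw [hinv] at hmk
        -- For an inverse letter the permutation of `a` is read backwards, from the longer suffix to
        -- the shorter.
        have hmem : of a * mk ((a, false) :: M) = mk M := by rw [hmk, mul_inv_cancel_left]
        have h := hp a ⟨mk ((a, false) :: M), _, hM, rfl⟩ ⟨M, hM', hmem.symm⟩
        rw [hinv, _root_.map_inv, lift_apply_of, Equiv.Perm.inv_eq_iff_eq]
        refine Subtype.ext (h.trans ?_).symm
        exact hmem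
  refine ⟨(lift p).ker, inferInstance, fun h => hw ?_⟩
  change mk L ∈ _ at h
  have h1 := key L (List.suffix_refl L)
  rw [MonoidHom.mem_ker.1 h] at h1
  exact (congrArg Subtype.val h1).symm

/-- The action of the permutations of `α` on the free group on `α`. -/
def permHom (α : Type*) : Equiv.Perm α →* MulAut (FreeGroup α) where
  toFun := freeGroupCongr
  map_one' := freeGroupCongr_refl
  map_mul' f g := (freeGroupCongr_trans g f).symm

theorem permHom_of {α : Type*} (f : Equiv.Perm α) (a : α) : permHom α f (of a) = of (f a) :=
  map.of

end FreeGroup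

namespace SemidirectProduct

instance residuallyFinite {N G : Type*} [Group N] [Group G] (φ : G →* MulAut N)
    [Group.ResiduallyFinite N] [Finite G] : Group.ResiduallyFinite (N ⋊[φ] G) := by
  refine Group.residuallyFinite_iff_exists_finiteIndex.2 fun w hw => ?_
  by_cases hr : rightHom w = 1
  · obtain ⟨n, rfl⟩ : w ∈ (inl : N →* N ⋊[φ] G).range := by
      rw [range_inl_eq_ker_rightHom]; exact hr
    have hn : n ≠ 1 := fun h => hw (by rw [h, map_one])
    obtain ⟨H, hH, hnH⟩ := Group.residuallyFinite_iff_exists_finiteIndex.1 ‹_› n hn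
    -- The index is multiplicative, and `N` has finite index because `G` is finite.
    refine ⟨H.map inl, ⟨?_⟩, fun h => hnH ?_⟩
    · rw [Subgroup.index_map_of_injective _ inl_injective, range_inl_eq_ker_rightHom]
      exact mul_ne_zero hH.index_ne_zero
        (Subgroup.finiteIndex_ker (rightHom : N ⋊[φ] G →* G)).index_ne_zero
    · obtain ⟨m, hm, h⟩ := h
      rwa [← inl_injective h]
  · exact ⟨(rightHom : N ⋊[φ] G →* G).ker, inferInstance, hr⟩

end SemidirectProduct

/-! ### Groups generated by a finite twisted subset -/

namespace Group

theorem pow_mem_of_twisted {B : Type*} [Group B] {T : Set B} (one : 1 ∈ T)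
    (twist : ∀ x ∈ T, ∀ y ∈ T, x * y * x ∈ T) {t : B} (ht : t ∈ T) : ∀ n : ℕ, t ^ n ∈ T
  | 0 => by simpa using one
  | 1 => by simpa using ht
  | n + 2 => by
    have h := twist t ht _ (pow_mem_of_twisted one twist ht n)
    rwa [← pow_succ', ← pow_succ] at h

theorem isOfFinOrder_of_twisted {B : Type*} [Group B] {T : Set B} (fin : T.Finite) (one : 1 ∈ T)
    (twist : ∀ x ∈ T, ∀ y ∈ T, x * y * x ∈ T) {t : B} (ht : t ∈ T) : IsOfFinOrder t := by
  by_contra h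
  refine Set.infinite_of_injective_forall_mem (injective_pow_iff_not_isOfFinOrder.2 h)
    (pow_mem_of_twisted one twist ht) fin

/-- The centre of a group generated by a finite twisted subset has finite index. -/
theorem finiteIndex_center_of_twisted {B : Type*} [Group B] {T : Set B} (fin : T.Finite)
    (gen : Subgroup.closure T = ⊤) (one : 1 ∈ T) (twist : ∀ x ∈ T, ∀ y ∈ T, x * y * x ∈ T) :
    (Subgroup.center B).FiniteIndex := by
  have := fin.to_subtype
  let f (t : T) : Equiv.Perm T := Equiv.ofBijective
    (fun y => ⟨t * y * t, twist t t.2 y y.2⟩)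
    (Finite.injective_iff_bijective.1 fun y z h => by
      simpa [Subtype.ext_iff] using h)
  let ρ : FreeGroup T →* Equiv.Perm T := FreeGroup.lift f
  -- A word acts on `T` by `y ↦ a * y * b`; `ε` records the pair `(a, b)`, the opposite group
  -- accounting for the reversed order on the right.
  let ε : FreeGroup T →* B × Bᵐᵒᵖ := FreeGroup.lift fun t => (t, MulOpposite.op t)
  have act : ∀ w y, (ρ w y : B) = (ε w).1 * y * (ε w).2.unop := by
    intro w
    induction w using FreeGroup.induction_on with
    | C1 => simp
    | of t => intro y; simp [ρ, ε, f]
    | inv_of t ih =>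
      intro y
      obtain ⟨z, rfl⟩ := (ρ (FreeGroup.of t)).surjective y
      rw [ih z]
      simp [mul_assoc]
    | mul v w hv hw => intro y; simp [hv, hw, mul_assoc]
  let π : FreeGroup T →* B := (MonoidHom.fst _ _).comp ε
  have hπ : Function.Surjective π := by
    rw [← MonoidHom.range_eq_top, eq_top_iff, ← gen, Subgroup.closure_le]
    exact fun t ht => ⟨FreeGroup.of ⟨t, ht⟩, by simp [π, ε]⟩
  have hfin : (ρ.ker.map π).FiniteIndex :=
    ⟨ne_zero_of_dvd_ne_zero (Subgroup.finiteIndex_ker ρ).index_ne_zero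
      (Subgroup.index_map_dvd _ hπ)⟩
  refine Subgroup.finiteIndex_of_le (H := ρ.ker.map π) ?_
  rintro _ ⟨w, hw, rfl⟩
  have hw' (y : T) : (ε w).1 * y * (ε w).2.unop = y := by
    rw [← act, MonoidHom.mem_ker.1 hw]; rfl
  -- For a word acting trivially, `y = 1` gives `b = a⁻¹`; then `a` commutes with all of `T` and is
  -- central.
  have h1 : (ε w).1 * (ε w).2.unop = 1 := by simpa using hw' ⟨1, one⟩
  rw [← Subgroup.centralizer_univ, ← Subgroup.coe_top, ← gen, Subgroup.centralizer_closure,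
    Subgroup.mem_centralizer_iff]
  intro y hy
  have h2 := hw' ⟨y, hy⟩
  rw [eq_inv_of_mul_eq_one_right h1, mul_inv_eq_iff_eq_mul] at h2
  exact h2.symm

open scoped IsMulCommutative in
/-- A group generated by a finite twisted subset is finite. -/
theorem finite_of_twisted {B : Type*} [Group B] {T : Set B} (fin : T.Finite)
    (gen : Subgroup.closure T = ⊤) (one : 1 ∈ T) (twist : ∀ x ∈ T, ∀ y ∈ T, x * y * x ∈ T) :
    Finite B := by
  have := finiteIndex_center_of_twisted fin gen one twist
  have : Group.FG B := Group.fg_iff.2 ⟨T, gen, fin⟩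
  -- Raising to the index of the centre is a homomorphism into an abelian group. It sends the
  -- torsion generators to torsion elements, so its whole image is torsion, and the finitely
  -- generated centre is finite.
  let τ := MonoidHom.transferCenterPow B
  have tors : (CommGroup.torsion (Subgroup.center B)).comap τ = ⊤ := by
    rw [eq_top_iff, ← gen, Subgroup.closure_le]
    exact fun t ht => MonoidHom.isOfFinOrder τ (isOfFinOrder_of_twisted fin one twist ht)
  have hcenter : IsMulTorsion (Subgroup.center B) := by
    intro z
    have hz : IsOfFinOrder (τ z) := by
      have : (z : B) ∈ (CommGroup.torsion (Subgroup.center B)).comap τ := tors ▸ Subgroup.mem_top _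
      exact this
    have : τ z = z ^ (Subgroup.center B).index :=
      Subtype.ext (MonoidHom.transferCenterPow_apply (z : B))
    rw [this] at hz
    exact (isOfFinOrder_pow.1 hz).resolve_right Subgroup.FiniteIndex.index_ne_zero
  have := CommGroup.finite_of_fg_isMulTorsion _ hcenter
  exact (Subgroup.finite_iff_finite_and_finiteIndex _).2 ⟨this, inferInstance⟩

/-- The subgroup generated by a finite twisted subset is finite. -/
theorem finite_closure_of_twisted {G : Type*} [Group G] {T : Set G} (fin : T.Finite)
    (one : 1 ∈ T) (twist : ∀ x ∈ T, ∀ y ∈ T, x * y * x ∈ T) : Finite (Subgroup.closure T) :=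
  finite_of_twisted (T := Subtype.val ⁻¹' T) (fin.preimage Subtype.val_injective.injOn)
    (Subgroup.closure_closure_coe_preimage) one fun x hx y hy => twist x hx y hy

end Group

/-! ### Right translations of a Bol loop -/

namespace BolLoop

section Translation

variable {S : Type*} [BolLoop S]

/-- The right multiplication by `x`. -/
noncomputable def rightMul (x : S) : Equiv.Perm S :=
  Equiv.ofBijective (· * x)
    ⟨fun y _ h => (existsUnique_mul_right x (y * x)).unique rfl h.symm,
      fun b => (existsUnique_mul_right x b).exists⟩

theorem rightMul_apply (x y : S) : rightMul x y = y * x := rfl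

theorem rightMul_one : rightMul (1 : S) = 1 := Equiv.ext fun y => mul_one y

theorem rightMul_mul_mul (x y : S) :
    rightMul ((x * y) * x) = rightMul x * rightMul y * rightMul x :=
  Equiv.ext fun z => (bol z x y).symm

theorem rightMul_inverse (x : S) : rightMul (inverse x) = (rightMul x)⁻¹ := by
  have h := rightMul_mul_mul x (inverse x)
  rw [mul_inverse, one_mul] at h
  refine eq_inv_of_mul_eq_one_right ?_
  exact mul_eq_right.1 h.symm

end Translation

/-! ### Residual finiteness of the universal group -/

namespace UniversalGroup

variable {S : Type*} [BolLoop S]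

theorem monoidHom_ext {H : Type*} [Group H] {f g : UniversalGroup S →* H}
    (hP : ∀ x, f (P x) = g (P x)) (hR : ∀ x, f (R x) = g (R x)) : f = g :=
  PresentedGroup.ext fun a => match a with
    | .P x => hP x
    | .R x => hR x

section Lift

variable {H : Type*} [Group H] (p r : S → H)

/-- The homomorphism from `G̃(S)` with given values on the generators. -/
def lift (p_one : p 1 = 1) (r_one : r 1 = 1) (p_inv : ∀ x, p (inverse x) = (p x)⁻¹)
    (r_inv : ∀ x, r (inverse x) = (r x)⁻¹) (p_mul : ∀ x y, p ((x * y) * x) = p x * p y * p x)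
    (r_mul : ∀ x y, r ((x * y) * x) = r x * r y * r x)
    (p_r : ∀ x y, p x * p y * (p (x * y))⁻¹ = (r x)⁻¹ * (r y)⁻¹ * r (x * y)) :
    UniversalGroup S →* H :=
  PresentedGroup.toGroup
    (f := fun g : Generator S => match g with
      | .P x => p x
      | .R x => r x)
    (by
      rintro w (_ | _ | x | x | ⟨x, y⟩ | ⟨x, y⟩ | ⟨x, y⟩)
      · simp [p_one]
      · simp [r_one]
      · simp [p_inv]
      · simp [r_inv]
      · simp [p_mul, mul_assoc]
      · simp [r_mul, mul_assoc]
      · simp [p_r])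

variable {p r} (p_one : p 1 = 1) (r_one : r 1 = 1) (p_inv : ∀ x, p (inverse x) = (p x)⁻¹)
    (r_inv : ∀ x, r (inverse x) = (r x)⁻¹) (p_mul : ∀ x y, p ((x * y) * x) = p x * p y * p x)
    (r_mul : ∀ x y, r ((x * y) * x) = r x * r y * r x)
    (p_r : ∀ x y, p x * p y * (p (x * y))⁻¹ = (r x)⁻¹ * (r y)⁻¹ * r (x * y))

theorem lift_P (x : S) : lift p r p_one r_one p_inv r_inv p_mul r_mul p_r (P x) = p x :=
  PresentedGroup.toGroup.of _

theorem lift_R (x : S) : lift p r p_one r_one p_inv r_inv p_mul r_mul p_r (R x) = r x :=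
  PresentedGroup.toGroup.of _

end Lift

theorem closure_P_R :
    Subgroup.closure (Set.range (P (S := S)) ∪ Set.range R) = (⊤ : Subgroup (UniversalGroup S)) :=
  (Subgroup.eq_top_iff' _).2 fun g => PresentedGroup.generated_by _ _ (fun a => match a with
    | .P x => Subgroup.subset_closure (.inl ⟨x, rfl⟩)
    | .R x => Subgroup.subset_closure (.inr ⟨x, rfl⟩)) g

variable (S)

/-- The folding endomorphism `P_x ↦ P_x`, `R_x ↦ P_x⁻¹` of `G̃(S)`. -/
def fold : UniversalGroup S →* UniversalGroup S :=
  lift P (fun x => (P x)⁻¹) P_one (by simp [P_one]) P_inv (by simp [P_inv]) P_mul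
    (by simp [P_mul, mul_assoc]) (by simp)

variable {S}

theorem fold_P (x : S) : fold S (P x) = P x := lift_P ..

theorem fold_R (x : S) : fold S (R x) = (P x)⁻¹ := lift_R ..

theorem fold_range_le : (fold S).range ≤ Subgroup.closure (Set.range P) := by
  rw [MonoidHom.range_eq_map, ← closure_P_R, MonoidHom.map_closure, Subgroup.closure_le]
  rintro _ ⟨_, ⟨x, rfl⟩ | ⟨x, rfl⟩, rfl⟩
  · rw [fold_P]
    exact Subgroup.subset_closure ⟨x, rfl⟩
  · rw [fold_R]
    exact inv_mem (Subgroup.subset_closure ⟨x, rfl⟩)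

theorem finite_closure_P [Finite S] : Finite (Subgroup.closure (Set.range (P (S := S)))) :=
  Group.finite_closure_of_twisted (Set.finite_range P) ⟨1, P_one⟩ (by
    rintro _ ⟨x, rfl⟩ _ ⟨y, rfl⟩
    exact ⟨_, P_mul x y⟩)

theorem finite_fold_range [Finite S] : Finite (fold S).range :=
  have := finite_closure_P (S := S)
  Finite.of_injective _ (Subgroup.inclusion_injective fold_range_le)

theorem L_one : L (1 : S) = 1 := by simp [L, P_one, R_one]

theorem L_conj_P (x y : S) : (P y)⁻¹ * L x * P y = L (x * y) * (L y)⁻¹ := by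
  have h : (R x)⁻¹ = P x * P y * (P (x * y))⁻¹ * (R (x * y))⁻¹ * R y := by
    rw [P_R]; group
  rw [L, L, L, h]
  group

variable (S) in
/-- The subgroup generated by the elements `L_x`. -/
def closureL : Subgroup (UniversalGroup S) := Subgroup.closure (Set.range L)

theorem L_mem (x : S) : L x ∈ closureL S := Subgroup.subset_closure ⟨x, rfl⟩

theorem P_mem_normalizer (y : S) :
    P y ∈ Subgroup.normalizer (closureL S : Set (UniversalGroup S)) := by
  have conj (y : S) : ∀ g ∈ closureL S, (P y)⁻¹ * g * P y ∈ closureL S := by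
    intro g hg
    have : closureL S ≤ (closureL S).comap (MulAut.conj (P y)⁻¹).toMonoidHom := by
      rw [closureL, Subgroup.closure_le]
      rintro _ ⟨x, rfl⟩
      change (P y)⁻¹ * L x * (P y)⁻¹⁻¹ ∈ closureL S
      rw [inv_inv, L_conj_P]
      exact mul_mem (L_mem _) (inv_mem (L_mem _))
    simpa using this hg
  refine Subgroup.mem_normalizer_iff.2 fun g => ⟨fun hg => ?_, fun hg => ?_⟩
  · simpa [P_inv] using conj (inverse y) g hg
  · simpa [mul_assoc] using conj y _ hg

instance closureL_normal : (closureL S).Normal := by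
  rw [← Subgroup.normalizer_eq_top_iff, eq_top_iff, ← closure_P_R, Subgroup.closure_le]
  rintro _ (⟨y, rfl⟩ | ⟨y, rfl⟩)
  · exact P_mem_normalizer y
  · have h : R y = (L y)⁻¹ * (P y)⁻¹ := by rw [L]; group
    rw [h]
    exact mul_mem (inv_mem (Subgroup.le_normalizer (L_mem y))) (inv_mem (P_mem_normalizer y))

/-- Modulo the `L x`, each `R x` equals `(P x)⁻¹`, so folding induces the identity on the quotient.
-/
theorem mem_closureL_of_fold_eq_one {g : UniversalGroup S} (hg : fold S g = 1) :
    g ∈ closureL S := by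
  have h : (QuotientGroup.mk' (closureL S)).comp (fold S) = QuotientGroup.mk' (closureL S) := by
    refine monoidHom_ext (fun x => ?_) fun x => ?_
    · rw [MonoidHom.comp_apply, fold_P]
    · rw [MonoidHom.comp_apply, fold_R, QuotientGroup.mk'_apply, QuotientGroup.mk'_apply,
        QuotientGroup.eq, inv_inv]
      have h : P x * R x = P x * (L x)⁻¹ * (P x)⁻¹ := by rw [L]; group
      rw [h]
      exact closureL_normal.conj_mem _ (inv_mem (L_mem x)) _
  have h' := DFunLike.congr_fun h g
  rw [MonoidHom.comp_apply, hg, map_one] at h'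
  exact (QuotientGroup.eq_one_iff g).1 h'.symm

theorem rightMul_fix_one (x y : S) :
    ((rightMul x)⁻¹ * (rightMul y)⁻¹ * rightMul (x * y)) 1 = 1 := by
  simp only [Equiv.Perm.mul_apply, Equiv.Perm.inv_eq_iff_eq, rightMul_apply, one_mul]

-- A permutation fixing the letter `1` commutes with it. This is what makes the mixed relation `P_R`
-- survive in `toSemidirect`, where the `R x` are conjugated by that letter.
open SemidirectProduct in
theorem inr_commute_inl_of {f : Equiv.Perm S} (hf : f 1 = 1) :
    inl (.of 1) * inr f * (inl (.of 1))⁻¹ =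
      (inr f : FreeGroup S ⋊[FreeGroup.permHom S] Equiv.Perm S) := by
  have h := inl_aut (φ := FreeGroup.permHom S) f (.of 1)
  rw [FreeGroup.permHom_of, hf] at h
  rw [mul_inv_eq_iff_eq_mul]
  nth_rw 1 [h]
  simp

variable (S) in
/-- The homomorphism of `G̃(S)` to the semidirect product of the free group on `S` and the
symmetric group of `S`, under which `L_x` goes to `x 1⁻¹`. -/
noncomputable def toSemidirect :
    UniversalGroup S →* FreeGroup S ⋊[FreeGroup.permHom S] Equiv.Perm S :=
  lift (fun x => SemidirectProduct.inr (rightMul x)⁻¹)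
    (fun x => SemidirectProduct.inl (.of 1) * SemidirectProduct.inr (rightMul x) *
      (SemidirectProduct.inl (.of 1))⁻¹)
    (by simp [rightMul_one]) (by simp [rightMul_one]) (by simp [rightMul_inverse])
    (by simp [rightMul_inverse, mul_assoc]) (by simp [rightMul_mul_mul, mul_assoc])
    (by simp [rightMul_mul_mul, mul_assoc])
    (by
      intro x y
      have h := inr_commute_inl_of (rightMul_fix_one x y)
      simp only [map_mul, map_inv] at h
      simp only [map_inv, inv_inv]
      rw [← h]
      group)

theorem toSemidirect_L (x : S) :
    toSemidirect S (L x) = SemidirectProduct.inl (.of x * (.of 1)⁻¹) := by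
  have h := SemidirectProduct.inl_aut (φ := FreeGroup.permHom S) (rightMul x) (.of 1)
  rw [FreeGroup.permHom_of, rightMul_apply, one_mul] at h
  rw [L, map_mul, map_inv, map_inv, map_mul, h, toSemidirect, lift_P, lift_R]
  simp [mul_assoc]

/-- Since `L 1 = 1`, evaluating letters as `L x` undoes `toSemidirect` on the subgroup generated by
the `L x`, which is therefore embedded. -/
theorem toSemidirect_of_mem_closureL {k : UniversalGroup S} (hk : k ∈ closureL S) :
    ∃ w, toSemidirect S k = SemidirectProduct.inl w ∧ FreeGroup.lift L w = k := by
  induction hk using Subgroup.closure_induction with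
  | mem k hk =>
    obtain ⟨x, rfl⟩ := hk
    exact ⟨_, toSemidirect_L x, by simp [L_one]⟩
  | one => exact ⟨1, by simp, by simp⟩
  | mul k l _ _ hk hl =>
    obtain ⟨v, hv, rfl⟩ := hk
    obtain ⟨w, hw, rfl⟩ := hl
    exact ⟨v * w, by rw [map_mul, hv, hw, map_mul], map_mul _ _ _⟩
  | inv k _ hk =>
    obtain ⟨v, hv, rfl⟩ := hk
    exact ⟨v⁻¹, by rw [map_inv, hv, map_inv], map_inv _ _⟩

theorem residuallyFinite [Finite S] : Group.ResiduallyFinite (UniversalGroup S) := by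
  refine Group.residuallyFinite_iff_exists_finiteIndex.2 fun g hg => ?_
  by_cases hf : fold S g = 1
  · have hne : toSemidirect S g ≠ 1 := by
      obtain ⟨w, hw, rfl⟩ := toSemidirect_of_mem_closureL (mem_closureL_of_fold_eq_one hf)
      intro h
      have hw1 : w = 1 := SemidirectProduct.inl_injective (by rw [← hw, h, map_one])
      exact hg (by rw [hw1, map_one])
    obtain ⟨H, hH, hgH⟩ := Group.residuallyFinite_iff_exists_finiteIndex.1 inferInstance _ hne
    exact ⟨H.comap (toSemidirect S), hH.comap _, hgH⟩
  · have := finite_fold_range (S := S)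
    exact ⟨(fold S).ker, inferInstance, hf⟩

/-! ### The group `G₀(S)` -/

/-- The union of the cosets J·R x is stable under right multiplication by `R y` and by `L y`, the
latter because `L x` and `R x` lie in the same coset. -/
theorem finiteIndex_J [Finite S] : (J S).FiniteIndex := by
  have hT (x : S) : L x * (R x)⁻¹ ∈ J S := Subgroup.subset_closure (.inl (.inl ⟨x, rfl⟩))
  have hR (x y : S) : R x * R y * (R (x * y))⁻¹ ∈ J S :=
    Subgroup.subset_closure (.inl (.inr ⟨(x, y), rfl⟩))
  have hL (x y : S) : L x * L y * (L (y * x))⁻¹ ∈ J S :=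
    Subgroup.subset_closure (.inr ⟨(x, y), rfl⟩)
  have step_R {g : UniversalGroup S} {x y : S} (h : g * (R x)⁻¹ ∈ J S) :
      g * R y * (R (x * y))⁻¹ ∈ J S := by
    simpa only [mul_assoc, inv_mul_cancel_left] using mul_mem h (hR x y)
  have step_L {g : UniversalGroup S} {x y : S} (h : g * (R x)⁻¹ ∈ J S) :
      g * L y * (R (y * x))⁻¹ ∈ J S := by
    simpa [mul_assoc] using
      mul_mem (mul_mem (mul_mem h (inv_mem (hT x))) (hL x y)) (hT (y * x))
  have cover (g : UniversalGroup S) : ∃ x : S, g * (R x)⁻¹ ∈ J S := by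
    have hg : g ∈ Subgroup.closure (Set.range (P (S := S)) ∪ Set.range R) :=
      closure_P_R (S := S) ▸ Subgroup.mem_top g
    have hP (g : UniversalGroup S) (y : S) (h : ∃ x : S, g * (R x)⁻¹ ∈ J S) :
        ∃ x : S, g * P y * (R x)⁻¹ ∈ J S := by
      obtain ⟨x, hx⟩ := h
      -- This reduces multiplication by `P y` to the two stable cases.
      have hy : P y = L (inverse y) * R (inverse y) := by rw [L, P_inv]; group
      exact ⟨_, by rw [hy, ← mul_assoc]; exact step_R (step_L hx)⟩
    have hR (g : UniversalGroup S) (y : S) (h : ∃ x : S, g * (R x)⁻¹ ∈ J S) :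
        ∃ x : S, g * R y * (R x)⁻¹ ∈ J S :=
      h.imp' (· * y) fun _ => step_R
    induction hg using Subgroup.closure_induction_right with
    | one => exact ⟨1, by simp [R_one]⟩
    | mul_right g _ y hy h =>
      obtain ⟨y, rfl⟩ | ⟨y, rfl⟩ := hy
      · exact hP g y h
      · exact hR g y h
    | mul_inv_cancel g _ y hy h =>
      obtain ⟨y, rfl⟩ | ⟨y, rfl⟩ := hy
      · rw [← P_inv]; exact hP g _ h
      · rw [← R_inv]; exact hR g _ h
  rw [Subgroup.finiteIndex_iff_finite_quotient]
  refine Finite.of_surjective (fun x : S => (((R x)⁻¹ : UniversalGroup S) : UniversalGroup S ⧸ J S))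
    fun q => ?_
  obtain ⟨g, rfl⟩ := QuotientGroup.mk_surjective q
  obtain ⟨x, hx⟩ := cover g⁻¹
  refine ⟨x, (QuotientGroup.eq.2 ?_).symm⟩
  exact hx

instance finiteIndex_sigmaCore [Finite S] : (sigmaCore S).FiniteIndex := by
  have hmap (H : Subgroup (UniversalGroup S)) [H.FiniteIndex] :
      (H.map (sigma (S := S)).toMonoidHom).FiniteIndex :=
    ⟨(Subgroup.index_map_equiv H (sigma (S := S))).trans_ne Subgroup.FiniteIndex.index_ne_zero⟩
  have := finiteIndex_J (S := S)
  have : (Jsigma S).FiniteIndex := hmap _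
  have := hmap (Jsigma S).normalCore
  unfold sigmaCore
  infer_instance

end UniversalGroup
end BolLoop

/-! ### Finite quotients of (σ, φ)-groups -/

namespace BolLoop

variable {G : Type*} [Group G] {σ : MulAut G}

theorem sigmaSet_subset : sigmaSet σ ⊆ sigmaSubgroup σ := Subgroup.subset_closure

theorem one_mem_sigmaSet : (1 : G) ∈ sigmaSet σ := ⟨1, by simp⟩

theorem sigma_eq_inv (hσ : ∀ g, σ (σ g) = g) {x : G} (hx : x ∈ sigmaSet σ) : σ x = x⁻¹ := by
  obtain ⟨y, rfl⟩ := hx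
  simp [hσ]

theorem sigmaSet_twist (hσ : ∀ g, σ (σ g) = g) {x y : G} (hx : x ∈ sigmaSet σ)
    (hy : y ∈ sigmaSet σ) : x * y * x ∈ sigmaSet σ := by
  obtain ⟨z, rfl⟩ := hy
  exact ⟨z * x⁻¹, by simp [sigma_eq_inv hσ hx, mul_assoc]⟩

variable (σ) in
instance sigmaSubgroup_normal : (sigmaSubgroup σ).Normal := by
  refine ⟨fun n hn g => ?_⟩
  have : sigmaSubgroup σ ≤ (sigmaSubgroup σ).comap (MulAut.conj g).toMonoidHom := by
    rw [sigmaSubgroup, Subgroup.closure_le]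
    rintro _ ⟨x, rfl⟩
    change g * (x⁻¹ * σ x) * g⁻¹ ∈ sigmaSubgroup σ
    have h : g * (x⁻¹ * σ x) * g⁻¹ =
        ((x * g⁻¹)⁻¹ * σ (x * g⁻¹)) * (g⁻¹⁻¹ * σ g⁻¹)⁻¹ := by
      simp [mul_assoc]
    rw [h]
    exact mul_mem (sigmaSet_subset ⟨_, rfl⟩) (inv_mem (sigmaSet_subset ⟨_, rfl⟩))
  exact this hn

variable {φ : sigmaSubgroup σ →* G}

theorem phiSet_eq_image : phiSet σ φ = φ '' (Subtype.val ⁻¹' sigmaSet σ) := rfl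

theorem closure_phiSet : Subgroup.closure (phiSet σ φ) = φ.range := by
  have h : Subgroup.closure (Subtype.val ⁻¹' sigmaSet σ : Set (sigmaSubgroup σ)) = ⊤ :=
    Subgroup.closure_closure_coe_preimage
  rw [phiSet_eq_image, ← MonoidHom.map_closure, h, ← MonoidHom.range_eq_map]

theorem one_mem_phiSet : (1 : G) ∈ phiSet σ φ := ⟨1, one_mem_sigmaSet, map_one φ⟩

theorem phiSet_twist (hσ : ∀ g, σ (σ g) = g) {x y : G} (hx : x ∈ phiSet σ φ)
    (hy : y ∈ phiSet σ φ) : x * y * x ∈ phiSet σ φ := by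
  obtain ⟨x, hx, rfl⟩ := hx
  obtain ⟨y, hy, rfl⟩ := hy
  exact ⟨x * y * x, sigmaSet_twist hσ hx hy, by simp⟩

namespace IsSigmaPhiGroup

theorem finite_range (h : IsSigmaPhiGroup σ φ) (fin : (phiSet σ φ).Finite) : Finite φ.range := by
  rw [← closure_phiSet]
  exact Group.finite_closure_of_twisted fin one_mem_phiSet
    fun x hx y hy => phiSet_twist h.involutory hx hy

/-- As `t⁻¹ * σ t` lies in N, the generators `t` and `σ t` agree modulo N; so the finite group φ(N)
maps onto G/N. -/
theorem finiteIndex_sigmaSubgroup (h : IsSigmaPhiGroup σ φ) (fin : (phiSet σ φ).Finite) :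
    (sigmaSubgroup σ).FiniteIndex := by
  have := h.finite_range fin
  let π := QuotientGroup.mk' (sigmaSubgroup σ)
  have hπ : Function.Surjective (fun g : φ.range => π g) := by
    have htop : (⊤ : Subgroup G).map π ≤ φ.range.map π := by
      rw [← h.generate, MonoidHom.map_closure, Subgroup.closure_le]
      have hφ {t : G} (ht : t ∈ phiSet σ φ) : π t ∈ φ.range.map π :=
        ⟨t, closure_phiSet (φ := φ) ▸ Subgroup.subset_closure ht, rfl⟩
      rintro _ ⟨_, ht | ⟨t, ht, rfl⟩, rfl⟩
      · exact hφ ht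
      · have hσ : π (σ t) = π t := (QuotientGroup.eq.2 (sigmaSet_subset ⟨t, rfl⟩)).symm
        rw [hσ]
        exact hφ ht
    intro q
    obtain ⟨g, rfl⟩ := QuotientGroup.mk'_surjective _ q
    obtain ⟨t, ht, hq⟩ := htop ⟨g, trivial, rfl⟩
    exact ⟨⟨t, ht⟩, hq⟩
  rw [Subgroup.finiteIndex_iff_finite_quotient]
  exact Finite.of_surjective _ hπ

/-- A `(σ, φ)`-group with a finite set `φ(G_σ)` has a normal `σ`-invariant subgroup of finite
index on which `φ` is trivial. -/
theorem exists_finiteIndex_le_ker (h : IsSigmaPhiGroup σ φ) (fin : (phiSet σ φ).Finite) :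
    ∃ M : Subgroup G, M.Normal ∧ M.FiniteIndex ∧ M.map (σ : G →* G) = M ∧
      ∀ n : sigmaSubgroup σ, (n : G) ∈ M → φ n = 1 := by
  have := h.finite_range fin
  have := h.finiteIndex_sigmaSubgroup fin
  let K := φ.ker.map (sigmaSubgroup σ).subtype
  have hK : K.FiniteIndex := ⟨by
    rw [Subgroup.index_map_subtype]
    exact mul_ne_zero Subgroup.FiniteIndex.index_ne_zero Subgroup.FiniteIndex.index_ne_zero⟩
  let C := K.normalCore
  have hC : (C.comap (σ : G →* G)).FiniteIndex :=
    Subgroup.FiniteIndex.comap _ inferInstance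
  -- Because σ is an involution, intersecting with one preimage already gives invariance.
  have hle : (C ⊓ C.comap (σ : G →* G)).map (σ : G →* G) ≤ C ⊓ C.comap (σ : G →* G) := by
    rintro _ ⟨g, hg, rfl⟩
    refine ⟨hg.2, ?_⟩
    change σ (σ g) ∈ C
    rw [h.involutory]
    exact hg.1
  refine ⟨C ⊓ C.comap (σ : G →* G), inferInstance, inferInstance, le_antisymm hle ?_, ?_⟩
  · intro g hg
    exact ⟨σ g, hle ⟨g, hg, rfl⟩, h.involutory g⟩
  · intro n hn
    obtain ⟨m, hm, hmn⟩ := K.normalCore_le hn.1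
    rwa [← Subtype.ext hmn]

end IsSigmaPhiGroup

/-- The quotient of a `(σ, φ)`-group by a normal `σ`-invariant subgroup on which `φ` is trivial is
associated with the same Bol loops. -/
theorem IsAssociated.exists_quotient {S : Type*} [BolLoop S] (h : IsAssociated S σ φ)
    (M : Subgroup G) [M.Normal] (hMσ : M.map (σ : G →* G) = M)
    (hMφ : ∀ n : sigmaSubgroup σ, (n : G) ∈ M → φ n = 1) :
    ∃ (τ : MulAut (G ⧸ M)) (ψ : sigmaSubgroup τ →* G ⧸ M), IsAssociated S τ ψ ∧
      (∀ g : G, QuotientGroup.mk' M (σ g) = τ (QuotientGroup.mk' M g)) ∧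
      ∀ (n : sigmaSubgroup σ) (m : sigmaSubgroup τ), (m : G ⧸ M) = QuotientGroup.mk' M n →
        ψ m = QuotientGroup.mk' M (φ n) := by
  obtain ⟨hG, P, hP, hPmul⟩ := h
  let τ : MulAut (G ⧸ M) := QuotientGroup.congr M M σ hMσ
  set π := QuotientGroup.mk' M with hπ_def
  have hπ : Function.Surjective π := QuotientGroup.mk'_surjective M
  have hτ (g : G) : π (σ g) = τ (π g) := rfl
  have hset : sigmaSet τ = π '' sigmaSet σ := by
    ext q
    constructor
    · rintro ⟨q, rfl⟩
      obtain ⟨g, rfl⟩ := hπ q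
      exact ⟨_, ⟨g, rfl⟩, by rw [map_mul, map_inv, hτ]⟩
    · rintro ⟨_, ⟨g, rfl⟩, rfl⟩
      exact ⟨π g, by rw [map_mul, map_inv, hτ]⟩
  have hN : sigmaSubgroup τ = (sigmaSubgroup σ).map π := by
    rw [sigmaSubgroup, hset, ← MonoidHom.map_closure]; rfl
  let ρ : sigmaSubgroup σ →* sigmaSubgroup τ := (π.comp (sigmaSubgroup σ).subtype).codRestrict _
    fun n => by rw [hN]; exact ⟨n, n.2, rfl⟩
  have hρ : Function.Surjective ρ := by
    rintro ⟨q, hq⟩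
    rw [hN] at hq
    obtain ⟨n, hn, rfl⟩ := hq
    exact ⟨⟨n, hn⟩, rfl⟩
  have hker : ρ.ker ≤ (π.comp φ).ker := by
    intro n hn
    have hn' : (n : G) ∈ M := (QuotientGroup.eq_one_iff _).1 (congrArg Subtype.val hn)
    rw [MonoidHom.mem_ker, MonoidHom.comp_apply, hMφ n hn', map_one]
  let ψ : sigmaSubgroup τ →* G ⧸ M := ρ.liftOfSurjective hρ ⟨π.comp φ, hker⟩
  have hψρ (n) : ψ (ρ n) = π (φ n) := ρ.liftOfRightInverse_comp_apply _ _ ⟨π.comp φ, hker⟩ n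
  have hψ (n : sigmaSubgroup σ) (m : sigmaSubgroup τ) (hm : (m : G ⧸ M) = π n) :
      ψ m = π (φ n) := by
    rw [← hψρ]
    congr 1
    exact Subtype.ext hm
  have hphi : phiSet τ ψ = π '' phiSet σ φ := by
    ext q
    constructor
    · rintro ⟨m, hm, rfl⟩
      rw [hset] at hm
      obtain ⟨n, hn, hnm⟩ := hm
      exact ⟨_, ⟨⟨n, sigmaSet_subset hn⟩, hn, rfl⟩, (hψ _ m hnm.symm).symm⟩
    · rintro ⟨_, ⟨n, hn, rfl⟩, rfl⟩
      exact ⟨ρ n, hset ▸ ⟨n, hn, rfl⟩, hψρ n⟩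
  have hfix {g : G} (hg : g ∈ fixedSubgroup σ φ) : π g ∈ fixedSubgroup τ ψ := by
    obtain ⟨⟨n, rfl⟩, hσ⟩ := hg
    exact ⟨⟨ρ n, hψρ n⟩, by rw [← hτ, hσ]⟩
  -- The axiom `phi_phi` recovers `x` from `x⁻¹ * σ x`. If `x` and `y` agree modulo M, then `x *
  -- y⁻¹` is the value of φ at an element of M, hence trivial; so the loop does not shrink.
  have hinj {x y : G} (hx : x ∈ phiSet σ φ) (hy : y ∈ phiSet σ φ) (hxy : π x = π y) : x = y := by
    have hφx := hG.phi_phi x hx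
    have hφy := hG.phi_phi y hy
    rw [← mul_inv_eq_one, ← hφx, ← hφy, ← map_inv, ← map_mul]
    refine hMφ _ ((QuotientGroup.eq_one_iff _).1 ?_)
    change π ((x⁻¹ * σ x) * (y⁻¹ * σ y)⁻¹) = 1
    simp only [map_mul, map_inv, hτ, hxy, mul_inv_cancel]
  refine ⟨τ, ψ, ⟨⟨?_, ?_, ?_, ?_⟩, fun x => π (P x), ⟨?_, ?_, ?_⟩, ?_⟩, hτ, hψ⟩
  · intro q
    obtain ⟨g, rfl⟩ := hπ q
    rw [← hτ, ← hτ, hG.involutory]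
  · have himage : τ '' (π '' phiSet σ φ) = π '' (σ '' phiSet σ φ) := by
      rw [Set.image_image, Set.image_image]
      rfl
    rw [hphi, himage, ← Set.image_union, ← MonoidHom.map_closure, hG.generate,
      ← MonoidHom.range_eq_map, MonoidHom.range_eq_top.2 hπ]
  · intro q hq
    rw [hphi] at hq
    obtain ⟨x, hx, rfl⟩ := hq
    rw [hψ ⟨x⁻¹ * σ x, sigmaSet_subset ⟨x, rfl⟩⟩ _ (by simp only [map_mul, map_inv, hτ]),
      hG.phi_phi x hx]
  · rintro _ ⟨m, rfl⟩
    obtain ⟨n, rfl⟩ := hρ m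
    obtain ⟨x, hx, hxn⟩ := hG.coset (φ n) ⟨n, rfl⟩
    refine ⟨π x, hphi ▸ ⟨x, hx, rfl⟩, ?_⟩
    rw [hψρ, ← map_inv, ← map_mul]
    exact hfix hxn
  · intro s hs
    rw [hphi]
    exact ⟨_, hP.mapsTo hs, rfl⟩
  · intro s hs t ht hst
    exact hP.injOn hs ht (hinj (hP.mapsTo hs) (hP.mapsTo ht) hst)
  · rw [hphi]
    rintro _ ⟨x, hx, rfl⟩
    obtain ⟨s, hs, rfl⟩ := hP.surjOn hx
    exact ⟨s, hs, rfl⟩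
  · intro x y
    simpa using hfix (hPmul x y)

theorem IsAssociated.finite_phiSet {S : Type*} [BolLoop S] [Finite S] (h : IsAssociated S σ φ) :
    (phiSet σ φ).Finite := by
  obtain ⟨P, hP, -⟩ := h.exists_bijOn
  exact hP.image_eq ▸ Set.toFinite _

/-- Every group associated with a finite Bol loop has a quotient by a normal subgroup of finite
index that is associated with the same loop. -/
theorem IsAssociated.exists_finite_quotient {S : Type*} [BolLoop S] [Finite S]
    (h : IsAssociated S σ φ) :
    ∃ (M : Subgroup G) (_ : M.Normal) (τ : MulAut (G ⧸ M)) (ψ : sigmaSubgroup τ →* G ⧸ M),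
      Finite (G ⧸ M) ∧ IsAssociated S τ ψ ∧
      (∀ g : G, QuotientGroup.mk' M (σ g) = τ (QuotientGroup.mk' M g)) ∧
      ∀ (n : sigmaSubgroup σ) (m : sigmaSubgroup τ), (m : G ⧸ M) = QuotientGroup.mk' M n →
        ψ m = QuotientGroup.mk' M (φ n) := by
  obtain ⟨M, hM, hfin, hMσ, hMφ⟩ := h.isSigmaPhiGroup.exists_finiteIndex_le_ker h.finite_phiSet
  obtain ⟨τ, ψ, hψ⟩ := h.exists_quotient M hMσ hMφ
  exact ⟨M, hM, τ, ψ, inferInstance, hψ⟩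

theorem IsLeastAssociated.finite {S : Type u} [BolLoop S] [Finite S] {G : Type u} [Group G]
    {σ : MulAut G} {φ : sigmaSubgroup σ →* G} (h : IsLeastAssociated S σ φ) : Finite G := by
  obtain ⟨M, _, τ, ψ, _, hψ, -, -⟩ := h.1.exists_finite_quotient
  obtain ⟨f, hf⟩ := h.2 _ τ ψ hψ
  exact Finite.of_surjective f hf

theorem IsMinimalAssociated.finite {S : Type u} [BolLoop S] [Finite S] {G : Type u} [Group G]
    {σ : MulAut G} {φ : sigmaSubgroup σ →* G} (h : IsMinimalAssociated S σ φ) : Finite G := by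
  obtain ⟨M, _, τ, ψ, _, hψ, hτ, hφ⟩ := h.1.exists_finite_quotient
  exact Finite.of_injective _
    (h.2 _ τ ψ (QuotientGroup.mk' M) hψ (QuotientGroup.mk'_surjective M) hτ hφ)

end BolLoop

theorem theorem3 (S : Type u) [BolLoop S] [Finite S] :
    Group.ResiduallyFinite (BolLoop.UniversalGroup S) ∧
    Finite (BolLoop.GroupZero S) ∧
    (∀ (G : Type u) [Group G] (σ : MulAut G) (φ : BolLoop.sigmaSubgroup σ →* G),
      BolLoop.IsLeastAssociated S σ φ → Finite G) ∧
    (∀ (G : Type u) [Group G] (σ : MulAut G) (φ : BolLoop.sigmaSubgroup σ →* G),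
      BolLoop.IsMinimalAssociated S σ φ → Finite G) :=
  ⟨BolLoop.UniversalGroup.residuallyFinite, inferInstance, fun _ _ _ _ h => h.finite,
    fun _ _ _ _ h => h.finite⟩
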